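/- Let $n\ge 1$ and let $\mathcal H_n=\{w=(z,t): z\in\mathbb C^n,\ t\in\mathbb R\}$ be the Heisenberg group with group law $$(z,t)(z',t')=\big(z+z',\ t+t'+2\,\mathrm{Im}\,(z\bar z')\big),\qquad z\bar z'=\sum_{j=1}^n z_j\overline{z_j'},$$ with Haar measure $dw=dz\,d\bar z\,dt$ normalised as $4^n\,dx\,dy\,dt$ (where $z=x+iy$), with $|w|=(|z|^4+t^2)^{1/4}$ and $d(w,w')=|w'^{-1}w|$. Theorem. Let $f\in\mathcal S(\mathcal H_n)$ be a complex-valued Schwartz function (that is, a Schwartz function on $\mathbb C^n\times\mathbb R\cong\mathbb R^{2n+1}$), let $0<\beta<1$ and $1\le p<2n/\beta$ with $p$ real. Then $$\int_{\mathcal H_n\times\mathcal H_n}\frac{|f(w)-f(w')|^p}{d(w,w')^{2n+2+p\beta}}\,dw\,dw'\ \ge\ F_{p,\beta}\int_{\mathcal H_n}|z|^{-p\beta}|f(w)|^p\,dw,$$ where, with $\lambda=(2n-p\beta)/p$ and any $\eta$ in the unit sphere $S^{2n-1}\subset\mathbb R^{2n}$, $$F_{p,\beta}=\frac{4^n\sqrt\pi\;\Gamma\!\left(\frac{2n+p\beta}{4}\right)}{\Gamma\!\left(\frac{2n+2+p\beta}{4}\right)}\int_{\mathbb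 R^{2n}}\big|1-|x|^{-\lambda}\big|^p\,|x-\eta|^{-2n-p\beta}\,dx .$$ -/

import Mathlib

open MeasureTheory
open scoped NNReal ENNReal ComplexConjugate

noncomputable section

/-- The underlying manifold `ℂⁿ × ℝ` of the Heisenberg group, with points `w = (z, t)`. The
additive (normed vector space) structure is the Euclidean one and is only used to speak about
Schwartz functions and Lebesgue measure; the Heisenberg group law is the multiplication below. -/
def Heisenberg (n : ℕ) : Type := EuclideanSpace ℂ (Fin n) × ℝ

namespace Heisenberg

instance (n : ℕ) : NormedAddCommGroup (Heisenberg n) :=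
  inferInstanceAs (NormedAddCommGroup (EuclideanSpace ℂ (Fin n) × ℝ))

instance (n : ℕ) : NormedSpace ℝ (Heisenberg n) :=
  inferInstanceAs (NormedSpace ℝ (EuclideanSpace ℂ (Fin n) × ℝ))

/-- Lebesgue measure `dx dy dt` on `ℂⁿ × ℝ`, where `z = x + iy`. -/
instance (n : ℕ) : MeasureSpace (Heisenberg n) :=
  inferInstanceAs (MeasureSpace (EuclideanSpace ℂ (Fin n) × ℝ))

instance (n : ℕ) : BorelSpace (Heisenberg n) :=
  inferInstanceAs (BorelSpace (EuclideanSpace ℂ (Fin n) × ℝ))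

instance (n : ℕ) : SigmaFinite (volume : Measure (Heisenberg n)) :=
  inferInstanceAs (SigmaFinite (volume : Measure (EuclideanSpace ℂ (Fin n) × ℝ)))

/-- The component `z ∈ ℂⁿ` of `w = (z, t)`. -/
def z {n : ℕ} (w : Heisenberg n) : EuclideanSpace ℂ (Fin n) := Prod.fst w

/-- The component `t ∈ ℝ` of `w = (z, t)`. -/
def t {n : ℕ} (w : Heisenberg n) : ℝ := Prod.snd w

/-- The point `(z, t)`. -/
def mk {n : ℕ} (z : EuclideanSpace ℂ (Fin n)) (t : ℝ) : Heisenberg n := Prod.mk z t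

/-- `Im (z z̄')`, where `z z̄' = ∑ j, z_j * conj z'_j`. -/
def imForm {n : ℕ} (z z' : EuclideanSpace ℂ (Fin n)) : ℝ :=
  (∑ j, z j * conj (z' j)).im

/-- `(z, t) (z', t') = (z + z', t + t' + 2 Im (z z̄'))`. -/
instance (n : ℕ) : Mul (Heisenberg n) :=
  ⟨fun w w' => mk (w.z + w'.z) (w.t + w'.t + 2 * imForm w.z w'.z)⟩

instance (n : ℕ) : One (Heisenberg n) := ⟨mk 0 0⟩

instance (n : ℕ) : Inv (Heisenberg n) := ⟨fun w => mk (-w.z) (-w.t)⟩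

theorem imForm_add_left {n : ℕ} (a b c : EuclideanSpace ℂ (Fin n)) :
    imForm (a + b) c = imForm a c + imForm b c := by
  simp [imForm, add_mul, Finset.sum_add_distrib]
  try ring

theorem imForm_add_right {n : ℕ} (a b c : EuclideanSpace ℂ (Fin n)) :
    imForm a (b + c) = imForm a b + imForm a c := by
  simp [imForm, mul_add, Finset.sum_add_distrib]
  try ring

theorem imForm_zero_left {n : ℕ} (a : EuclideanSpace ℂ (Fin n)) : imForm 0 a = 0 := by
  simp [imForm]

theorem imForm_zero_right {n : ℕ} (a : EuclideanSpace ℂ (Fin n)) : imForm a 0 = 0 := by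
  simp [imForm]

theorem imForm_neg_self {n : ℕ} (a : EuclideanSpace ℂ (Fin n)) : imForm (-a) a = 0 := by
  simp [imForm, mul_comm]

/-- The Heisenberg group. -/
instance (n : ℕ) : Group (Heisenberg n) :=
  Group.ofLeftAxioms
    (fun a b c => by
      change mk (a.z + b.z + c.z)
          (a.t + b.t + 2 * imForm a.z b.z + c.t + 2 * imForm (a.z + b.z) c.z) =
        mk (a.z + (b.z + c.z))
          (a.t + (b.t + c.t + 2 * imForm b.z c.z) + 2 * imForm a.z (b.z + c.z))
      rw [imForm_add_left, imForm_add_right, add_assoc a.z]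
      congr 1
      ring)
    (fun a => by
      change mk (0 + a.z) (0 + a.t + 2 * imForm 0 a.z) = mk a.z a.t
      rw [imForm_zero_left]
      simp)
    (fun a => by
      change mk (-a.z + a.z) (-a.t + a.t + 2 * imForm (-a.z) a.z) = mk 0 0
      rw [imForm_neg_self]
      simp)

/-- Haar measure `dw = dz dz̄ dt`, normalised as `4ⁿ dx dy dt`. -/
def haar (n : ℕ) : Measure (Heisenberg n) := ((4 : ℝ≥0) ^ n) • (volume : Measure (Heisenberg n))

/-- The homogeneous norm `|w| = (|z|⁴ + t²)^(1/4)`. -/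
def gauge {n : ℕ} (w : Heisenberg n) : ℝ := (‖w.z‖ ^ 4 + w.t ^ 2) ^ (1 / 4 : ℝ)

/-- The metric `d(w, w') = |w'⁻¹ w|`. -/
def d {n : ℕ} (w w' : Heisenberg n) : ℝ := gauge (w'⁻¹ * w)

/-- The constant `F_{p,β}`, as an extended non-negative number, with `η` a point of the unit
sphere of `ℝ²ⁿ`. -/
def constF (n : ℕ) (p β : ℝ) (η : EuclideanSpace ℝ (Fin (2 * n))) : ℝ≥0∞ :=
  ENNReal.ofReal
      (4 ^ n * √Real.pi * Real.Gamma ((2 * n + p * β) / 4) /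
        Real.Gamma ((2 * n + 2 + p * β) / 4)) *
    ∫⁻ x : EuclideanSpace ℝ (Fin (2 * n)),
      ENNReal.ofReal
        (|1 - ‖x‖ ^ (-((2 * n - p * β) / p))| ^ p * ‖x - η‖ ^ (-(2 * n) - p * β))

end Heisenberg

end

open Set Metric Module

/-!
In polar coordinates for `z`, the measure `d(w, w') ^ (-(2n + 2 + pβ)) dw dw'` splits into pieces
on which the ratio `ρ = |z'| / |z|` is fixed. By homogeneity the two marginals of such a piece are
`φ(ρ)` and `ρ ^ (-λp) φ(ρ)` times `|z| ^ (-pβ) dw`, where `λ = (2n - pβ) / p`, so the reverse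
triangle inequality in `L^p` bounds the contribution of `|f(w) - f(w')| ^ p` from below by
`|1 - ρ ^ (-λ)| ^ p φ(ρ) ∫ |z| ^ (-pβ) |f| ^ p dw`. Integrating `d ^ (-(2n + 2 + pβ))` over the
central variable gives a Gamma quotient times `|z - z'| ^ (-2n - pβ)`; hence `φ` is an integral over
the unit sphere of `ℂⁿ`, and integrating over `ρ` reassembles the integral over `ℝ²ⁿ` that defines
the constant.
-/

section ReverseTriangle

theorem ofReal_abs_one_sub_rpow_mul_lintegral_le {Y V : Type*} [MeasurableSpace Y]
    [NormedAddCommGroup V] {κ : Measure Y} {f g : Y → V} {p m : ℝ} (hp : 1 ≤ p) (hm : 0 ≤ m)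
    (hf : AEStronglyMeasurable f κ) (hg : AEStronglyMeasurable g κ)
    (hfin : ∫⁻ y, ‖f y‖ₑ ^ p ∂κ ≠ ∞)
    (hfg : ∫⁻ y, ‖g y‖ₑ ^ p ∂κ = ENNReal.ofReal (m ^ p) * ∫⁻ y, ‖f y‖ₑ ^ p ∂κ) :
    ENNReal.ofReal (|1 - m| ^ p) * ∫⁻ y, ‖f y‖ₑ ^ p ∂κ ≤ ∫⁻ y, ‖f y - g y‖ₑ ^ p ∂κ := by
  have hp0 : 0 < p := by linarith
  have norm_g : eLpNorm' g p κ = ENNReal.ofReal m * eLpNorm' f p κ := by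
    rw [eLpNorm'_eq_lintegral_enorm, hfg, ENNReal.mul_rpow_of_nonneg _ _ (by positivity),
      ← ENNReal.ofReal_rpow_of_nonneg hm hp0.le, ← ENNReal.rpow_mul, mul_one_div_cancel hp0.ne',
      ENNReal.rpow_one, eLpNorm'_eq_lintegral_enorm]
  have f_le : eLpNorm' f p κ ≤ eLpNorm' (f - g) p κ + eLpNorm' g p κ := by
    simpa using eLpNorm'_add_le (hf.sub hg) hg hp
  have g_le : eLpNorm' g p κ ≤ eLpNorm' (f - g) p κ + eLpNorm' f p κ := by
    rw [← eLpNorm'_neg (f - g)]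
    simpa using eLpNorm'_add_le (hf.sub hg).neg hf hp
  have f_ne_top : eLpNorm' f p κ ≠ ∞ := ENNReal.rpow_ne_top_of_nonneg (by positivity) hfin
  have key : ENNReal.ofReal |1 - m| * eLpNorm' f p κ ≤ eLpNorm' (f - g) p κ := by
    rw [norm_g] at f_le g_le
    rcases abs_cases (1 - m) with ⟨h, -⟩ | ⟨h, -⟩
    · rw [h, ENNReal.ofReal_sub _ hm, ENNReal.sub_mul fun _ _ => f_ne_top, ENNReal.ofReal_one,
        one_mul]
      exact tsub_le_iff_right.2 f_le
    · rw [h, neg_sub, ENNReal.ofReal_sub _ zero_le_one, ENNReal.sub_mul fun _ _ => f_ne_top,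
        ENNReal.ofReal_one, one_mul]
      exact tsub_le_iff_right.2 g_le
  calc ENNReal.ofReal (|1 - m| ^ p) * ∫⁻ y, ‖f y‖ₑ ^ p ∂κ
      = (ENNReal.ofReal |1 - m| * eLpNorm' f p κ) ^ p := by
        rw [ENNReal.mul_rpow_of_nonneg _ _ hp0.le, ENNReal.ofReal_rpow_of_nonneg (abs_nonneg _)
          hp0.le, lintegral_rpow_enorm_eq_rpow_eLpNorm' hp0]
    _ ≤ eLpNorm' (f - g) p κ ^ p := by gcongr
    _ = ∫⁻ y, ‖f y - g y‖ₑ ^ p ∂κ := (lintegral_rpow_enorm_eq_rpow_eLpNorm' hp0).symm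

end ReverseTriangle

section HalfLine

theorem setLIntegral_Ioi_comp_mul_left (g : ℝ → ℝ≥0∞) {c : ℝ} (hc : 0 < c) :
    ∫⁻ r in Ioi 0, g (c * r) = ENNReal.ofReal c⁻¹ * ∫⁻ r in Ioi 0, g r := by
  have hemb : MeasurableEmbedding fun r : ℝ => c * r :=
    (Homeomorph.mulLeft₀ c hc.ne').measurableEmbedding
  have hpre : (fun r : ℝ => c * r) ⁻¹' Ioi 0 = Ioi 0 := by ext; simp [hc]
  rw [← hemb.lintegral_map, ← hpre, ← hemb.restrict_map, Real.map_volume_mul_left hc.ne',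
    Measure.restrict_smul, lintegral_smul_measure, abs_of_pos (inv_pos.2 hc), smul_eq_mul, hpre]

variable {Ω V : Type*} [MeasurableSpace Ω] [NormedAddCommGroup V]

theorem ofReal_mul_ofReal_rpow_sub_two {r : ℝ} (hr : 0 < r) (a : ℝ) :
    ENNReal.ofReal r * ENNReal.ofReal (r ^ (a - 2)) = ENNReal.ofReal (r ^ (a - 1)) := by
  rw [← ENNReal.ofReal_mul hr.le, mul_comm, ← Real.rpow_add_one hr.ne']
  ring_nf

/-- A kernel `J` on pairs of points of `(0, ∞) × Ω`, homogeneous of degree `a - 2` in the radial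
variables once one of the two angular variables has been integrated out against `m`. The profile
`φ` records the dependence on the ratio `ρ` of the radii; the ratio `ρ = 1` is left out because
singular kernels blow up there. -/
structure HasHomogeneousMarginals (m : Measure Ω) (J : (ℝ × Ω) × (ℝ × Ω) → ℝ≥0∞) (a : ℝ)
    (φ : ℝ → ℝ≥0∞) : Prop where
  measurable : Measurable J
  lintegral_right : ∀ r > 0, ∀ ρ > 0, ρ ≠ 1 → ∀ ω,
    ∫⁻ ω', J ((r, ω), (ρ * r, ω')) ∂m = ENNReal.ofReal (r ^ (a - 2)) * φ ρ
  lintegral_left : ∀ r > 0, ∀ ρ > 0, ρ ≠ 1 → ∀ ω',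
    ∫⁻ ω, J ((r, ω), (ρ * r, ω')) ∂m = ENNReal.ofReal (r ^ (a - 2)) * φ ρ

/-- The part of the measure `J(x, y) dx dy` carried by the pairs `x = (r, ω)`, `y = (ρ r, ω')`,
parametrised by `((r, ω), ω')`. The factor `r` is the Jacobian of `r' = ρ r`. -/
noncomputable def dilationCoupling (m : Measure Ω) (J : (ℝ × Ω) × (ℝ × Ω) → ℝ≥0∞) (ρ : ℝ) :
    Measure ((ℝ × Ω) × Ω) :=
  (((volume.restrict (Ioi 0)).prod m).prod m).withDensity fun x =>
    ENNReal.ofReal x.1.1 * J (x.1, (ρ * x.1.1, x.2))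

variable {m : Measure Ω} [SFinite m] {J : (ℝ × Ω) × (ℝ × Ω) → ℝ≥0∞} {a p ρ : ℝ}
  {φ : ℝ → ℝ≥0∞}

theorem lintegral_dilationCoupling (hJ : Measurable J) {u : (ℝ × Ω) × Ω → ℝ≥0∞}
    (hu : Measurable u) :
    ∫⁻ x, u x ∂dilationCoupling m J ρ =
      ∫⁻ x, ∫⁻ ω', ENNReal.ofReal x.1 * (J (x, (ρ * x.1, ω')) * u (x, ω')) ∂m
        ∂(volume.restrict (Ioi 0)).prod m := by
  rw [dilationCoupling, lintegral_withDensity_eq_lintegral_mul _ (by fun_prop) hu,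
    lintegral_prod _ (by fun_prop)]
  simp only [Pi.mul_apply, mul_assoc]

theorem lintegral_mul_eq_lintegral_dilationCoupling (hJ : Measurable J)
    {G : (ℝ × Ω) × (ℝ × Ω) → ℝ≥0∞} (hG : Measurable G) :
    ∫⁻ q, G q * J q ∂((volume.restrict (Ioi 0)).prod m).prod ((volume.restrict (Ioi 0)).prod m) =
      ∫⁻ ρ in Ioi 0, ∫⁻ x, G (x.1, (ρ * x.1.1, x.2)) ∂dilationCoupling m J ρ := by
  simp_rw [fun ρ => lintegral_dilationCoupling (m := m) (ρ := ρ) hJ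
    (u := fun x => G (x.1, (ρ * x.1.1, x.2))) (by fun_prop)]
  rw [lintegral_lintegral_swap, lintegral_prod _ (by fun_prop)]
  · have hpos : ∀ᵐ x ∂(volume.restrict (Ioi (0 : ℝ))).prod m, 0 < x.1 :=
      Measure.quasiMeasurePreserving_fst.ae (ae_restrict_mem measurableSet_Ioi)
    refine lintegral_congr_ae (hpos.mono fun x hx => ?_)
    calc ∫⁻ y, G (x, y) * J (x, y) ∂(volume.restrict (Ioi 0)).prod m
        = ∫⁻ r in Ioi 0, ∫⁻ ω', G (x, (r, ω')) * J (x, (r, ω')) ∂m :=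
          lintegral_prod _ (by fun_prop)
      _ = ENNReal.ofReal x.1 *
            ∫⁻ ρ in Ioi 0, ∫⁻ ω', G (x, (x.1 * ρ, ω')) * J (x, (x.1 * ρ, ω')) ∂m := by
          rw [setLIntegral_Ioi_comp_mul_left
              (fun r => ∫⁻ ω', G (x, (r, ω')) * J (x, (r, ω')) ∂m) hx, ← mul_assoc,
            ← ENNReal.ofReal_mul hx.le, mul_inv_cancel₀ hx.ne', ENNReal.ofReal_one, one_mul]
      _ = ∫⁻ ρ in Ioi 0, ∫⁻ ω', ENNReal.ofReal x.1 *
            (J (x, (ρ * x.1, ω')) * G (x, (ρ * x.1, ω'))) ∂m := by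
          rw [← lintegral_const_mul' _ _ ENNReal.ofReal_ne_top]
          refine lintegral_congr fun ρ => ?_
          rw [← lintegral_const_mul' _ _ ENNReal.ofReal_ne_top, mul_comm ρ]
          simp only [mul_comm]
  · exact Measurable.aemeasurable (Measurable.lintegral_prod_right (by fun_prop))

theorem HasHomogeneousMarginals.lintegral_fst_dilationCoupling
    (h : HasHomogeneousMarginals m J a φ) (hρ : 0 < ρ) (hρ1 : ρ ≠ 1) {u : ℝ × Ω → ℝ≥0∞}
    (hu : Measurable u) :
    ∫⁻ x, u x.1 ∂dilationCoupling m J ρ =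
      φ ρ * ∫⁻ x, ENNReal.ofReal (x.1 ^ (a - 1)) * u x ∂(volume.restrict (Ioi 0)).prod m := by
  have hJ := h.measurable
  have hpos : ∀ᵐ x ∂(volume.restrict (Ioi (0 : ℝ))).prod m, 0 < x.1 :=
    Measure.quasiMeasurePreserving_fst.ae (ae_restrict_mem measurableSet_Ioi)
  rw [lintegral_dilationCoupling hJ (u := fun x => u x.1) (by fun_prop),
    ← lintegral_const_mul _ (by fun_prop)]
  refine lintegral_congr_ae (hpos.mono fun x hx => ?_)
  change ∫⁻ ω', ENNReal.ofReal x.1 * (J (x, (ρ * x.1, ω')) * u x) ∂m = _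
  rw [lintegral_const_mul _ (by fun_prop), lintegral_mul_const _ (by fun_prop),
    h.lintegral_right x.1 hx ρ hρ hρ1, ← mul_assoc, ← mul_assoc,
    ofReal_mul_ofReal_rpow_sub_two hx, mul_comm _ (φ ρ), mul_assoc]

theorem HasHomogeneousMarginals.lintegral_snd_dilationCoupling
    (h : HasHomogeneousMarginals m J a φ) (hρ : 0 < ρ) (hρ1 : ρ ≠ 1) {u : ℝ × Ω → ℝ≥0∞}
    (hu : Measurable u) :
    ∫⁻ x, u (ρ * x.1.1, x.2) ∂dilationCoupling m J ρ =
      ENNReal.ofReal (ρ ^ (-a)) * (φ ρ *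
        ∫⁻ x, ENNReal.ofReal (x.1 ^ (a - 1)) * u x ∂(volume.restrict (Ioi 0)).prod m) := by
  have hJ := h.measurable
  set g : ℝ → ℝ≥0∞ := fun r => ∫⁻ ω', ENNReal.ofReal (r ^ (a - 1)) * u (r, ω') ∂m with hg
  have slice : ∀ r > 0, ∫⁻ ω, ∫⁻ ω', ENNReal.ofReal r *
      (J ((r, ω), (ρ * r, ω')) * u (ρ * r, ω')) ∂m ∂m =
      φ ρ * ENNReal.ofReal (ρ ^ (1 - a)) * g (ρ * r) := by
    intro r hr
    rw [lintegral_lintegral_swap (by fun_prop), hg, ← lintegral_const_mul _ (by fun_prop)]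
    refine lintegral_congr fun ω' => ?_
    have hr_pow : r ^ (a - 1) = ρ ^ (1 - a) * (ρ * r) ^ (a - 1) := by
      rw [Real.mul_rpow hρ.le hr.le, ← mul_assoc, ← Real.rpow_add hρ, sub_add_sub_cancel', sub_self,
        Real.rpow_zero, one_mul]
    rw [lintegral_const_mul _ (by fun_prop), lintegral_mul_const _ (by fun_prop),
      h.lintegral_left r hr ρ hρ hρ1, ← mul_assoc, ← mul_assoc, ofReal_mul_ofReal_rpow_sub_two hr,
      hr_pow, ENNReal.ofReal_mul (by positivity)]
    ring
  rw [lintegral_dilationCoupling hJ (u := fun x => u (ρ * x.1.1, x.2)) (by fun_prop),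
    lintegral_prod _ (by fun_prop), lintegral_prod _ (by fun_prop),
    setLIntegral_congr_fun measurableSet_Ioi slice, lintegral_const_mul _ (by fun_prop),
    setLIntegral_Ioi_comp_mul_left g hρ, ← mul_assoc, mul_assoc (φ ρ),
    ← ENNReal.ofReal_mul (by positivity), ← Real.rpow_neg_one, ← Real.rpow_add hρ,
    mul_left_comm, mul_assoc]
  congr 4
  ring

theorem HasHomogeneousMarginals.hardy (h : HasHomogeneousMarginals m J a φ) (hp : 1 ≤ p)
    (hφ : ∀ ρ > 0, ρ ≠ 1 → φ ρ ≠ ∞) {f : ℝ × Ω → V} (hf : StronglyMeasurable f)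
    (hfin : ∫⁻ x, ENNReal.ofReal (x.1 ^ (a - 1)) * ‖f x‖ₑ ^ p
      ∂(volume.restrict (Ioi 0)).prod m ≠ ∞) :
    (∫⁻ ρ in Ioi 0, ENNReal.ofReal (|1 - ρ ^ (-(a / p))| ^ p) * φ ρ) *
        ∫⁻ x, ENNReal.ofReal (x.1 ^ (a - 1)) * ‖f x‖ₑ ^ p ∂(volume.restrict (Ioi 0)).prod m ≤
      ∫⁻ q, ‖f q.1 - f q.2‖ₑ ^ p * J q
        ∂((volume.restrict (Ioi 0)).prod m).prod ((volume.restrict (Ioi 0)).prod m) := by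
  have hJ := h.measurable
  rw [lintegral_mul_eq_lintegral_dilationCoupling hJ (by fun_prop),
    ← lintegral_mul_const' _ _ hfin]
  refine lintegral_mono_ae ?_
  filter_upwards [ae_restrict_mem measurableSet_Ioi,
    ae_restrict_of_ae (Measure.ae_ne volume (1 : ℝ))] with ρ hρ hρ1
  have fst := h.lintegral_fst_dilationCoupling hρ hρ1 (u := fun x => ‖f x‖ₑ ^ p) (by fun_prop)
  have snd := h.lintegral_snd_dilationCoupling hρ hρ1 (u := fun x => ‖f x‖ₑ ^ p) (by fun_prop)
  have hm : (ρ ^ (-(a / p))) ^ p = ρ ^ (-a) := by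
    rw [← Real.rpow_mul (le_of_lt hρ)]
    field_simp
  rw [mul_assoc, ← fst]
  rw [← fst, ← hm] at snd
  refine ofReal_abs_one_sub_rpow_mul_lintegral_le hp (Real.rpow_nonneg (le_of_lt hρ) _)
    ?_ ?_ ?_ snd
  · exact (hf.comp_measurable (by fun_prop)).aestronglyMeasurable
  · exact (hf.comp_measurable (by fun_prop)).aestronglyMeasurable
  · rw [fst]
    exact ENNReal.mul_ne_top (hφ ρ hρ hρ1) hfin

end HalfLine

section Polar

variable {E T : Type*} [NormedAddCommGroup E] [NormedSpace ℝ E] [FiniteDimensional ℝ E]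
  [Nontrivial E] [MeasurableSpace E] [BorelSpace E] [MeasurableSpace T]
  (μ : Measure E) [μ.IsAddHaarMeasure] (ν : Measure T) [SFinite ν]

theorem lintegral_eq_lintegral_polar {F : E → ℝ≥0∞} (hF : Measurable F) :
    ∫⁻ x, F x ∂μ = ∫⁻ r in Ioi (0 : ℝ), ENNReal.ofReal (r ^ (finrank ℝ E - 1)) *
      ∫⁻ θ : sphere (0 : E) 1, F (r • (θ : E)) ∂μ.toSphere := by
  calc ∫⁻ x, F x ∂μ = ∫⁻ x : ({0}ᶜ : Set E), F x.1 ∂μ.comap Subtype.val := by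
        rw [lintegral_subtype_comap (measurableSet_singleton _).compl F, restrict_compl_singleton]
    _ = ∫⁻ x, F (x.2.1 • x.1.1) ∂μ.toSphere.prod (.volumeIoiPow (finrank ℝ E - 1)) := by
        rw [← μ.measurePreserving_homeomorphUnitSphereProd.lintegral_comp_emb
          (Homeomorph.measurableEmbedding _)]
        refine lintegral_congr fun x => ?_
        have hx : ‖(x : E)‖ ≠ 0 := norm_ne_zero_iff.2 x.2
        simp [smul_smul, hx]
    _ = ∫⁻ r : Ioi (0 : ℝ), ENNReal.ofReal (r.1 ^ (finrank ℝ E - 1)) *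
          ∫⁻ θ : sphere (0 : E) 1, F (r.1 • (θ : E)) ∂μ.toSphere ∂volume.comap Subtype.val := by
        rw [lintegral_prod_symm _ (by fun_prop), Measure.volumeIoiPow,
          lintegral_withDensity_eq_lintegral_mul _ (by fun_prop)]
        · rfl
        · exact Measurable.lintegral_prod_right (by fun_prop)
    _ = _ := by rw [← lintegral_subtype_comap measurableSet_Ioi]

theorem lintegral_prod_eq_lintegral_polar {F : E × T → ℝ≥0∞} (hF : Measurable F) :
    ∫⁻ x, F x ∂μ.prod ν = ∫⁻ y, ENNReal.ofReal (y.1 ^ (finrank ℝ E - 1)) *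
      F (y.1 • (y.2.1 : E), y.2.2) ∂(volume.restrict (Ioi (0 : ℝ))).prod (μ.toSphere.prod ν) := by
  rw [lintegral_prod _ (by fun_prop),
    lintegral_eq_lintegral_polar μ (F := fun z => ∫⁻ t, F (z, t) ∂ν) (by fun_prop),
    lintegral_prod _ (by fun_prop)]
  refine lintegral_congr fun r => ?_
  rw [← lintegral_prod (fun y : sphere (0 : E) 1 × T => F (r • (y.1 : E), y.2)) (by fun_prop),
    ← lintegral_const_mul _ (by fun_prop)]

theorem lintegral_prod_prod_eq_lintegral_polar {F : (E × T) × (E × T) → ℝ≥0∞}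
    (hF : Measurable F) :
    ∫⁻ q, F q ∂(μ.prod ν).prod (μ.prod ν) =
      ∫⁻ q, ENNReal.ofReal (q.1.1 ^ (finrank ℝ E - 1)) *
          ENNReal.ofReal (q.2.1 ^ (finrank ℝ E - 1)) *
          F ((q.1.1 • (q.1.2.1 : E), q.1.2.2), (q.2.1 • (q.2.2.1 : E), q.2.2.2))
        ∂((volume.restrict (Ioi (0 : ℝ))).prod (μ.toSphere.prod ν)).prod
          ((volume.restrict (Ioi (0 : ℝ))).prod (μ.toSphere.prod ν)) := by
  rw [lintegral_prod _ (by fun_prop), lintegral_prod_eq_lintegral_polar μ ν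
    (F := fun x => ∫⁻ y, F (x, y) ∂μ.prod ν) (by fun_prop),
    lintegral_prod (μ := (volume.restrict (Ioi 0)).prod (μ.toSphere.prod ν)) _ (by fun_prop)]
  refine lintegral_congr fun x => ?_
  rw [lintegral_prod_eq_lintegral_polar μ ν (by fun_prop), ← lintegral_const_mul _ (by fun_prop)]
  simp only [mul_assoc]

end Polar

section SphereKernel

theorem ne_smul_of_norm_eq {E : Type*} [NormedAddCommGroup E] [NormedSpace ℝ E] {x y : E}
    (hx : x ≠ 0) (h : ‖x‖ = ‖y‖) {ρ : ℝ} (hρ : 0 < ρ) (hρ1 : ρ ≠ 1) : x ≠ ρ • y := by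
  rintro rfl
  rw [norm_smul, Real.norm_of_nonneg hρ.le, mul_eq_right₀] at h
  · exact hρ1 h
  · exact norm_ne_zero_iff.2 (right_ne_zero_of_smul hx)

open scoped Pointwise

variable {E : Type*} [NormedAddCommGroup E] [InnerProductSpace ℝ E] [FiniteDimensional ℝ E]
  [MeasurableSpace E] [BorelSpace E]

theorem lintegral_toSphere_comp_isometry (R : E ≃ₗᵢ[ℝ] E) {h : E → ℝ≥0∞} (hh : Measurable h) :
    ∫⁻ θ : sphere (0 : E) 1, h (R θ) ∂(volume : Measure E).toSphere =
      ∫⁻ θ : sphere (0 : E) 1, h θ ∂(volume : Measure E).toSphere := by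
  have hR : Measurable R := R.continuous.measurable
  have cone (s : Set E) : Ioo (0 : ℝ) 1 • (sphere 0 1 ∩ R ⁻¹' s) =
      R ⁻¹' (Ioo (0 : ℝ) 1 • (sphere 0 1 ∩ s)) := by
    ext x
    simp only [mem_preimage, Set.mem_smul, mem_inter_iff, mem_sphere_zero_iff_norm]
    constructor
    · rintro ⟨c, hc, y, ⟨hy, hys⟩, rfl⟩
      exact ⟨c, hc, R y, ⟨by rwa [R.norm_map], hys⟩, (map_smul R c y).symm⟩
    · rintro ⟨c, hc, y, ⟨hy, hys⟩, hx⟩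
      exact ⟨c, hc, R.symm y, ⟨by rwa [R.symm.norm_map], by simpa using hys⟩,
        by rw [← map_smul, hx, R.symm_apply_apply]⟩
  have map_eq : ((volume : Measure E).toSphere.map (↑)).map R =
      (volume : Measure E).toSphere.map (↑) := by
    ext s hs
    rw [Measure.map_apply hR hs, Measure.map_apply measurable_subtype_coe (hR hs),
      Measure.map_apply measurable_subtype_coe hs,
      Measure.toSphere_apply' _ (measurable_subtype_coe (hR hs)),
      Measure.toSphere_apply' _ (measurable_subtype_coe hs), Subtype.image_preimage_coe,
      Subtype.image_preimage_coe, cone,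
      R.measurePreserving.measure_preimage_emb R.toHomeomorph.measurableEmbedding]
  rw [← lintegral_map hh measurable_subtype_coe, ← map_eq, lintegral_map hh hR,
    lintegral_map (by fun_prop) measurable_subtype_coe]

/-- The integral of `θ ↦ ‖η - ρ θ‖ ^ e` over the unit sphere. For a unit vector `η` this is the
angular integral of the kernel `‖x - y‖ ^ e` between spheres whose radii have ratio `ρ`. -/
noncomputable def sphereKernel (η : E) (e ρ : ℝ) : ℝ≥0∞ :=
  ∫⁻ θ : sphere (0 : E) 1, ENNReal.ofReal (‖η - ρ • (θ : E)‖ ^ e) ∂(volume : Measure E).toSphere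

theorem sphereKernel_eq_of_norm_eq {η η' : E} (h : ‖η‖ = ‖η'‖) (e ρ : ℝ) :
    sphereKernel η e ρ = sphereKernel η' e ρ := by
  obtain ⟨R, rfl⟩ : ∃ R : E ≃ₗᵢ[ℝ] E, R η = η' := ⟨_, Submodule.reflection_sub h⟩
  rw [sphereKernel, sphereKernel, ← lintegral_toSphere_comp_isometry R
    (h := fun θ => ENNReal.ofReal (‖R η - ρ • θ‖ ^ e)) (by fun_prop)]
  simp only [← map_smul, ← map_sub, R.norm_map]

theorem sphereKernel_ne_top {η : E} (hη : ‖η‖ = 1) (e : ℝ) {ρ : ℝ} (hρ : 0 < ρ) (hρ1 : ρ ≠ 1) :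
    sphereKernel η e ρ ≠ ∞ := by
  have cont : Continuous fun θ : sphere (0 : E) 1 => ‖η - ρ • (θ : E)‖ ^ e :=
    Continuous.rpow_const (by fun_prop) fun θ => Or.inl <| norm_ne_zero_iff.2 <| sub_ne_zero.2 <|
      ne_smul_of_norm_eq (norm_ne_zero_iff.1 (by simp [hη])) (by simp [hη]) hρ hρ1
  exact (cont.integrable_of_hasCompactSupport
    (HasCompactSupport.of_compactSpace _)).lintegral_lt_top.ne

theorem lintegral_sphere_norm_smul_sub_smul_rpow_right {η : E} (hη : ‖η‖ = 1) (e : ℝ)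
    {r : ℝ} (hr : 0 < r) (ρ : ℝ) (θ : sphere (0 : E) 1) :
    ∫⁻ θ' : sphere (0 : E) 1, ENNReal.ofReal (‖r • (θ : E) - (ρ * r) • (θ' : E)‖ ^ e)
        ∂(volume : Measure E).toSphere =
      ENNReal.ofReal (r ^ e) * sphereKernel η e ρ := by
  rw [sphereKernel_eq_of_norm_eq (hη.trans (norm_eq_of_mem_sphere θ).symm), sphereKernel,
    ← lintegral_const_mul _ (by fun_prop)]
  refine lintegral_congr fun θ' => ?_
  rw [← ENNReal.ofReal_mul (by positivity), ← Real.mul_rpow hr.le (norm_nonneg _), mul_comm ρ,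
    mul_smul, ← smul_sub, norm_smul, Real.norm_of_nonneg hr.le]

theorem lintegral_sphere_norm_smul_sub_smul_rpow_left {η : E} (hη : ‖η‖ = 1) (e : ℝ)
    {r : ℝ} (hr : 0 < r) (ρ : ℝ) (θ' : sphere (0 : E) 1) :
    ∫⁻ θ : sphere (0 : E) 1, ENNReal.ofReal (‖r • (θ : E) - (ρ * r) • (θ' : E)‖ ^ e)
        ∂(volume : Measure E).toSphere =
      ENNReal.ofReal (r ^ e) * sphereKernel η e ρ := by
  rw [← lintegral_sphere_norm_smul_sub_smul_rpow_right hη e hr ρ θ']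
  refine lintegral_congr fun θ => ?_
  congr 2
  rw [← sq_eq_sq₀ (norm_nonneg _) (norm_nonneg _), norm_sub_sq_real, norm_sub_sq_real]
  simp only [norm_smul, inner_smul_left, inner_smul_right, real_inner_comm (θ : E) (θ' : E),
    norm_eq_of_mem_sphere, conj_trivial]

end SphereKernel

section FractionalHardy

variable {E T V : Type*} [NormedAddCommGroup E] [InnerProductSpace ℝ E] [FiniteDimensional ℝ E]
  [MeasurableSpace E] [BorelSpace E] [MeasurableSpace T] [NormedAddCommGroup V]

/-- The constant of the fractional Hardy inequality of order `α` and exponent `p` on `E`, for a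
unit vector `η`; it does not depend on the choice of `η`. -/
noncomputable def fractionalHardyConst (p α : ℝ) (η : E) : ℝ≥0∞ :=
  ∫⁻ x : E, ENNReal.ofReal
    (|1 - ‖x‖ ^ (-((finrank ℝ E - α) / p))| ^ p * ‖x - η‖ ^ (-finrank ℝ E - α))

theorem fractionalHardyConst_comp_isometry {F : Type*} [NormedAddCommGroup F]
    [InnerProductSpace ℝ F] [FiniteDimensional ℝ F] [MeasurableSpace F] [BorelSpace F]
    (R : E ≃ₗᵢ[ℝ] F) (p α : ℝ) (η : E) :
    fractionalHardyConst p α (R η) = fractionalHardyConst p α η := by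
  rw [fractionalHardyConst, ← R.measurePreserving.lintegral_comp_emb
    R.toHomeomorph.measurableEmbedding]
  simp only [← map_sub, R.norm_map, ← R.toLinearEquiv.finrank_eq]
  rfl

theorem fractionalHardyConst_eq_lintegral_sphereKernel [Nontrivial E] (p α : ℝ) (η : E) :
    fractionalHardyConst p α η = ∫⁻ ρ in Ioi (0 : ℝ),
      ENNReal.ofReal (|1 - ρ ^ (-((finrank ℝ E - α) / p))| ^ p) *
        (ENNReal.ofReal (ρ ^ (finrank ℝ E - 1)) * sphereKernel η (-finrank ℝ E - α) ρ) := by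
  rw [fractionalHardyConst, lintegral_eq_lintegral_polar _ (by fun_prop)]
  refine setLIntegral_congr_fun measurableSet_Ioi fun ρ (hρ : 0 < ρ) => ?_
  simp only [norm_smul, norm_eq_of_mem_sphere, mul_one, Real.norm_of_nonneg hρ.le]
  simp_rw [ENNReal.ofReal_mul (Real.rpow_nonneg (abs_nonneg _) p),
    norm_sub_rev _ η]
  rw [lintegral_const_mul _ (by fun_prop), mul_left_comm, sphereKernel]

/-- A kernel `W` on `E × T` whose integrals over either of the two variables in `T` are
`C ‖z - z'‖ ^ (-(dim E) - α)`, the kernel of the fractional Sobolev seminorm of order `α` on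
`E`. -/
structure HasFractionalMarginals (ν : Measure T) (W : (E × T) × (E × T) → ℝ≥0∞) (α : ℝ)
    (C : ℝ≥0∞) : Prop where
  measurable : Measurable W
  lintegral_right : ∀ z z' t, z ≠ z' →
    ∫⁻ t', W ((z, t), (z', t')) ∂ν = C * ENNReal.ofReal (‖z - z'‖ ^ (-finrank ℝ E - α))
  lintegral_left : ∀ z z' t', z ≠ z' →
    ∫⁻ t, W ((z, t), (z', t')) ∂ν = C * ENNReal.ofReal (‖z - z'‖ ^ (-finrank ℝ E - α))

variable {ν : Measure T} [SFinite ν] {W : (E × T) × (E × T) → ℝ≥0∞} {p α : ℝ} {C : ℝ≥0∞} {η : E}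

/-- The density of `W(q, q') dq dq'` in polar coordinates for the `E` components, which is where
the dilation coupling applies. -/
noncomputable def polarKernel (W : (E × T) × (E × T) → ℝ≥0∞)
    (q : (ℝ × sphere (0 : E) 1 × T) × (ℝ × sphere (0 : E) 1 × T)) : ℝ≥0∞ :=
  ENNReal.ofReal (q.1.1 ^ (finrank ℝ E - 1)) * ENNReal.ofReal (q.2.1 ^ (finrank ℝ E - 1)) *
    W ((q.1.1 • (q.1.2.1 : E), q.1.2.2), (q.2.1 • (q.2.2.1 : E), q.2.2.2))

theorem ofReal_pow_mul_ofReal_pow_mul {N : ℕ} (hN : N ≠ 0) (α : ℝ) {r ρ : ℝ} (hr : 0 < r)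
    (hρ : 0 < ρ) (C S : ℝ≥0∞) :
    ENNReal.ofReal (r ^ (N - 1)) * ENNReal.ofReal ((ρ * r) ^ (N - 1)) *
        (C * (ENNReal.ofReal (r ^ (-N - α)) * S)) =
      ENNReal.ofReal (r ^ (N - α - 2)) * (C * (ENNReal.ofReal (ρ ^ (N - 1)) * S)) := by
  have hpow : r ^ (N - 1) * (ρ * r) ^ (N - 1) * r ^ (-N - α) =
      r ^ (N - α - 2) * ρ ^ (N - 1) := by
    obtain ⟨k, rfl⟩ := Nat.exists_eq_add_one_of_ne_zero hN
    have hexp : ((k + 1 : ℕ) : ℝ) - α - 2 = k + k + (-((k + 1 : ℕ) : ℝ) - α) := by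
      push_cast
      ring
    rw [hexp, Real.rpow_add hr, Real.rpow_add hr, Real.rpow_natCast, mul_pow,
      Nat.add_sub_cancel]
    ring
  have hpow' := congrArg ENNReal.ofReal hpow
  rw [ENNReal.ofReal_mul (by positivity), ENNReal.ofReal_mul (by positivity),
    ENNReal.ofReal_mul (by positivity)] at hpow'
  rw [mul_left_comm C, ← mul_assoc, hpow', mul_assoc, mul_left_comm C]

theorem HasFractionalMarginals.hasHomogeneousMarginals_polarKernel [Nontrivial E]
    (h : HasFractionalMarginals ν W α C) (hη : ‖η‖ = 1) :
    HasHomogeneousMarginals ((volume : Measure E).toSphere.prod ν) (polarKernel W)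
      (finrank ℝ E - α) fun ρ => C *
        (ENNReal.ofReal (ρ ^ (finrank ℝ E - 1)) * sphereKernel η (-finrank ℝ E - α) ρ) := by
  have hW := h.measurable
  have hN := (finrank_pos (R := ℝ) (M := E)).ne'
  have hne : ∀ r : ℝ, 0 < r → ∀ ρ : ℝ, 0 < ρ → ρ ≠ 1 → ∀ θ θ' : sphere (0 : E) 1,
      r • (θ : E) ≠ (ρ * r) • (θ' : E) := fun r hr ρ hρ hρ1 θ θ' => by
    rw [mul_smul]
    exact ne_smul_of_norm_eq (smul_ne_zero hr.ne' (ne_zero_of_mem_unit_sphere θ))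
      (by simp [norm_smul]) hρ hρ1
  refine ⟨by unfold polarKernel; fun_prop, fun r hr ρ hρ hρ1 ω => ?_,
    fun r hr ρ hρ hρ1 ω' => ?_⟩
  · rw [← ofReal_pow_mul_ofReal_pow_mul hN α hr hρ]
    simp only [polarKernel]
    rw [lintegral_const_mul _ (by fun_prop), lintegral_prod _ (by fun_prop),
      lintegral_congr fun θ' => h.lintegral_right _ _ ω.2 (hne r hr ρ hρ hρ1 ω.1 θ'),
      lintegral_const_mul _ (by fun_prop),
      lintegral_sphere_norm_smul_sub_smul_rpow_right hη _ hr]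
  · rw [← ofReal_pow_mul_ofReal_pow_mul hN α hr hρ]
    simp only [polarKernel]
    rw [lintegral_const_mul _ (by fun_prop), lintegral_prod _ (by fun_prop),
      lintegral_congr fun θ => h.lintegral_left _ _ ω'.2 (hne r hr ρ hρ hρ1 θ ω'.1),
      lintegral_const_mul _ (by fun_prop),
      lintegral_sphere_norm_smul_sub_smul_rpow_left hη _ hr]

theorem HasFractionalMarginals.hardy (h : HasFractionalMarginals ν W α C) (hC : C ≠ ∞)
    (hp : 1 ≤ p) (hη : ‖η‖ = 1) {f : E × T → V} (hf : StronglyMeasurable f)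
    (hfin : ∫⁻ q, ENNReal.ofReal (‖q.1‖ ^ (-α)) * ‖f q‖ₑ ^ p ∂(volume : Measure E).prod ν ≠ ∞) :
    C * fractionalHardyConst p α η *
        ∫⁻ q, ENNReal.ofReal (‖q.1‖ ^ (-α)) * ‖f q‖ₑ ^ p ∂(volume : Measure E).prod ν ≤
      ∫⁻ q, ‖f q.1 - f q.2‖ₑ ^ p * W q
        ∂((volume : Measure E).prod ν).prod ((volume : Measure E).prod ν) := by
  have hE : Nontrivial E := ⟨η, 0, norm_ne_zero_iff.1 (by simp [hη])⟩
  have hW := h.measurable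
  have weight_polar : ∫⁻ q, ENNReal.ofReal (‖q.1‖ ^ (-α)) * ‖f q‖ₑ ^ p
      ∂(volume : Measure E).prod ν = ∫⁻ y, ENNReal.ofReal (y.1 ^ (finrank ℝ E - α - 1)) *
        ‖f (y.1 • (y.2.1 : E), y.2.2)‖ₑ ^ p
          ∂(volume.restrict (Ioi 0)).prod ((volume : Measure E).toSphere.prod ν) := by
    rw [lintegral_prod_eq_lintegral_polar _ _ (by fun_prop)]
    have hpos : ∀ᵐ y ∂(volume.restrict (Ioi (0 : ℝ))).prod
        ((volume : Measure E).toSphere.prod ν), 0 < y.1 :=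
      Measure.quasiMeasurePreserving_fst.ae (ae_restrict_mem measurableSet_Ioi)
    refine lintegral_congr_ae (hpos.mono fun y hy => ?_)
    have hN : 1 ≤ finrank ℝ E := finrank_pos
    simp only [norm_smul, norm_eq_of_mem_sphere, mul_one, Real.norm_of_nonneg hy.le]
    rw [← mul_assoc, ← ENNReal.ofReal_mul (by positivity), ← Real.rpow_natCast,
      ← Real.rpow_add hy, Nat.cast_sub hN, Nat.cast_one, sub_add_eq_add_sub, ← sub_eq_add_neg]
  rw [weight_polar] at hfin ⊢
  have hfP : StronglyMeasurable fun y : ℝ × sphere (0 : E) 1 × T =>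
      f (y.1 • (y.2.1 : E), y.2.2) := hf.comp_measurable (by fun_prop)
  have key := (h.hasHomogeneousMarginals_polarKernel hη).hardy hp (fun ρ hρ hρ1 =>
    ENNReal.mul_ne_top hC (ENNReal.mul_ne_top ENNReal.ofReal_ne_top
      (sphereKernel_ne_top hη _ hρ hρ1))) hfP hfin
  simp_rw [mul_left_comm _ C] at key
  rw [lintegral_const_mul' _ _ hC, ← fractionalHardyConst_eq_lintegral_sphereKernel] at key
  refine key.trans_eq ?_
  rw [lintegral_prod_prod_eq_lintegral_polar (volume : Measure E) ν (by fun_prop)]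
  simp only [polarKernel, mul_left_comm]

end FractionalHardy

section Gamma

theorem lintegral_rpow_mul_exp_neg_mul_Ioi {a r : ℝ} (ha : 0 < a) (hr : 0 < r) :
    ∫⁻ x in Ioi (0 : ℝ), ENNReal.ofReal (x ^ (a - 1) * Real.exp (-(r * x))) =
      ENNReal.ofReal (r ^ (-a) * Real.Gamma a) := by
  have integral_eq := Real.integral_rpow_mul_exp_neg_mul_Ioi ha hr
  rw [one_div, Real.inv_rpow hr.le, ← Real.rpow_neg hr.le] at integral_eq
  have integrable : IntegrableOn (fun x : ℝ => x ^ (a - 1) * Real.exp (-(r * x))) (Ioi 0) :=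
    Integrable.of_integral_ne_zero (integral_eq.trans_ne
      (mul_pos (Real.rpow_pos_of_pos hr _) (Real.Gamma_pos_of_pos ha)).ne')
  rw [← integral_eq, ofReal_integral_eq_lintegral_ofReal integrable]
  filter_upwards [ae_restrict_mem measurableSet_Ioi] with x (hx : 0 < x)
  positivity

theorem lintegral_rpow_mul_exp_neg_add_sq_mul (b s : ℝ) {x : ℝ} (hx : 0 < x) :
    ∫⁻ u : ℝ, ENNReal.ofReal (x ^ (s - 1) * Real.exp (-((b + u ^ 2) * x))) =
      ENNReal.ofReal √Real.pi *
        ENNReal.ofReal (x ^ (s - 1 / 2 - 1) * Real.exp (-(b * x))) := by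
  have hsplit : ∀ u : ℝ, x ^ (s - 1) * Real.exp (-((b + u ^ 2) * x)) =
      x ^ (s - 1) * Real.exp (-(b * x)) * Real.exp (-x * u ^ 2) := fun u => by
    rw [mul_assoc, ← Real.exp_add]
    ring_nf
  have hsqrt : √(Real.pi / x) = √Real.pi * x ^ (-(1 / 2) : ℝ) := by
    rw [Real.sqrt_div Real.pi_pos.le, Real.rpow_neg hx.le, ← Real.sqrt_eq_rpow, div_eq_mul_inv]
  simp only [hsplit]
  rw [← ofReal_integral_eq_lintegral_ofReal ((integrable_exp_neg_mul_sq hx).const_mul _)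
      (.of_forall fun u => by positivity), integral_const_mul, integral_gaussian, hsqrt,
    ← ENNReal.ofReal_mul (Real.sqrt_nonneg _), sub_right_comm, sub_eq_add_neg (s - 1),
    Real.rpow_add hx]
  ring_nf

theorem lintegral_add_sq_rpow_neg {b s : ℝ} (hb : 0 < b) (hs : 1 / 2 < s) :
    ∫⁻ u : ℝ, ENNReal.ofReal ((b + u ^ 2) ^ (-s)) =
      ENNReal.ofReal (√Real.pi * Real.Gamma (s - 1 / 2) / Real.Gamma s) *
        ENNReal.ofReal (b ^ (1 / 2 - s)) := by
  have hs0 : 0 < s := by linarith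
  have hΓ : 0 < Real.Gamma s := Real.Gamma_pos_of_pos hs0
  -- Writing the power as a Gamma integral makes the integral over `u` Gaussian.
  have gamma_mul : ENNReal.ofReal (Real.Gamma s) *
        ∫⁻ u : ℝ, ENNReal.ofReal ((b + u ^ 2) ^ (-s)) =
      ENNReal.ofReal √Real.pi * ENNReal.ofReal (b ^ (1 / 2 - s) * Real.Gamma (s - 1 / 2)) := by
    calc ENNReal.ofReal (Real.Gamma s) * ∫⁻ u : ℝ, ENNReal.ofReal ((b + u ^ 2) ^ (-s))
        = ∫⁻ u : ℝ, ∫⁻ x in Ioi (0 : ℝ),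
            ENNReal.ofReal (x ^ (s - 1) * Real.exp (-((b + u ^ 2) * x))) := by
          rw [← lintegral_const_mul _ (by fun_prop)]
          refine lintegral_congr fun u => ?_
          rw [lintegral_rpow_mul_exp_neg_mul_Ioi hs0 (by positivity), ← ENNReal.ofReal_mul hΓ.le,
            mul_comm]
      _ = ∫⁻ x in Ioi (0 : ℝ), ∫⁻ u : ℝ,
            ENNReal.ofReal (x ^ (s - 1) * Real.exp (-((b + u ^ 2) * x))) :=
          lintegral_lintegral_swap (by fun_prop)
      _ = ∫⁻ x in Ioi (0 : ℝ), ENNReal.ofReal √Real.pi *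
            ENNReal.ofReal (x ^ (s - 1 / 2 - 1) * Real.exp (-(b * x))) :=
          setLIntegral_congr_fun measurableSet_Ioi fun x hx =>
            lintegral_rpow_mul_exp_neg_add_sq_mul b s hx
      _ = _ := by
          rw [lintegral_const_mul _ (by fun_prop),
            lintegral_rpow_mul_exp_neg_mul_Ioi (by linarith) hb, neg_sub]
  rw [← ENNReal.mul_right_inj (ENNReal.ofReal_pos.2 hΓ).ne' ENNReal.ofReal_ne_top, gamma_mul,
    ← ENNReal.ofReal_mul (by positivity), ← ENNReal.ofReal_mul' (by positivity),
    ← ENNReal.ofReal_mul hΓ.le]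
  congr 1
  field_simp

end Gamma

section Decay

variable {E F V : Type*} [NormedAddCommGroup E] [NormedSpace ℝ E]
  [NormedAddCommGroup F] [NormedSpace ℝ F] [FiniteDimensional ℝ F]
  [MeasurableSpace F] [BorelSpace F] (ν : Measure F) [ν.IsAddHaarMeasure]
  [NormedAddCommGroup V] [NormedSpace ℝ V] {α p : ℝ}

theorem exists_enorm_rpow_le_snd_of_schwartz (f : SchwartzMap (E × F) V) (hp : 0 < p) :
    ∃ g : F → ℝ≥0∞, Measurable g ∧ ∫⁻ t, g t ∂ν ≠ ∞ ∧ ∀ q, ‖f q‖ₑ ^ p ≤ g q.2 := by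
  obtain ⟨k, hk⟩ := exists_nat_gt (finrank ℝ F / p)
  obtain ⟨A, hA⟩ : ∃ A : ℝ, ∀ q, (1 + ‖q‖) ^ k * ‖f q‖ ≤ A := ⟨_, fun q => by
    simpa only [norm_iteratedFDeriv_zero] using
      f.one_add_le_sup_seminorm_apply (𝕜 := ℝ) (m := (k, 0)) le_rfl le_rfl q⟩
  have hA0 : 0 ≤ A := le_trans (by positivity) (hA 0)
  refine ⟨fun t => ENNReal.ofReal (A ^ p * (1 + ‖t‖) ^ (-(k * p))), by fun_prop,
    ((integrable_one_add_norm ((div_lt_iff₀ hp).1 hk)).const_mul _).lintegral_lt_top.ne,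
    fun q => ?_⟩
  have hfq : ‖f q‖ ≤ A * (1 + ‖q.2‖) ^ (-k : ℝ) := by
    rw [Real.rpow_neg (by positivity), Real.rpow_natCast, ← div_eq_mul_inv,
      le_div_iff₀ (by positivity), mul_comm]
    refine le_trans ?_ (hA q)
    gcongr
    exact norm_snd_le q
  rw [← ofReal_norm, ENNReal.ofReal_rpow_of_nonneg (norm_nonneg _) hp.le]
  refine ENNReal.ofReal_le_ofReal ((Real.rpow_le_rpow (norm_nonneg _) hfq hp.le).trans_eq ?_)
  rw [Real.mul_rpow hA0 (by positivity), ← Real.rpow_mul (by positivity), neg_mul]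

variable [FiniteDimensional ℝ E] [MeasurableSpace E] [BorelSpace E] (μ : Measure E)
  [μ.IsAddHaarMeasure]

theorem integrableOn_norm_rpow_neg_ball [Nontrivial E] (hαE : α < finrank ℝ E) :
    IntegrableOn (fun z : E => ‖z‖ ^ (-α)) (ball 0 1) μ := by
  have radial : IntegrableOn (fun r : ℝ => r ^ (finrank ℝ E - 1 - α)) (Ioo 0 1) :=
    (intervalIntegral.intervalIntegrable_rpow' (by linarith)).1.mono_set Ioo_subset_Ioc_self
  rw [integrableOn_fun_norm_addHaar μ (f := fun r : ℝ => r ^ (-α))]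
  refine radial.congr_fun (fun r hr => ?_) measurableSet_Ioo
  rw [smul_eq_mul, ← Real.rpow_natCast, ← Real.rpow_add hr.1, Nat.cast_pred finrank_pos,
    sub_eq_add_neg]

theorem lintegral_norm_fst_rpow_mul_schwartz_ne_top (f : SchwartzMap (E × F) V)
    (hα : 0 ≤ α) (hαE : α < finrank ℝ E) (hp : 0 < p) :
    ∫⁻ q, ENNReal.ofReal (‖q.1‖ ^ (-α)) * ‖f q‖ₑ ^ p ∂μ.prod ν ≠ ∞ := by
  have : Nontrivial E :=
    nontrivial_of_finrank_pos (R := ℝ) (by exact_mod_cast hα.trans_lt hαE)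
  obtain ⟨g, hg, hg_fin, hfg⟩ := exists_enorm_rpow_le_snd_of_schwartz ν f hp
  set w : E → ℝ≥0∞ := (ball 0 1).indicator fun z => ENNReal.ofReal (‖z‖ ^ (-α)) with hw
  have hw_meas : Measurable w := Measurable.indicator (by fun_prop) measurableSet_ball
  have hw_fin : ∫⁻ z, w z ∂μ ≠ ∞ := by
    rw [hw, lintegral_indicator measurableSet_ball]
    exact (integrableOn_norm_rpow_neg_ball μ hαE).lintegral_lt_top.ne
  have weight_le : ∀ z : E, ENNReal.ofReal (‖z‖ ^ (-α)) ≤ w z + 1 := fun z => by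
    by_cases hz : z ∈ ball (0 : E) 1
    · rw [hw, indicator_of_mem hz]
      exact le_self_add
    · refine le_add_left (ENNReal.ofReal_le_one.2 ?_)
      exact Real.rpow_le_one_of_one_le_of_nonpos (by simpa using hz) (neg_nonpos.2 hα)
  have near : ∫⁻ q, w q.1 * g q.2 ∂μ.prod ν ≠ ∞ := by
    rw [lintegral_prod_mul hw_meas.aemeasurable hg.aemeasurable]
    exact ENNReal.mul_ne_top hw_fin hg_fin
  have far : ∫⁻ q, ‖f q‖ₑ ^ p ∂μ.prod ν ≠ ∞ := by
    have key := lintegral_rpow_enorm_lt_top_of_eLpNorm_lt_top (ENNReal.ofReal_pos.2 hp).ne'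
      ENNReal.ofReal_ne_top (f.memLp (ENNReal.ofReal p) (μ.prod ν)).eLpNorm_lt_top
    rw [ENNReal.toReal_ofReal hp.le] at key
    exact key.ne
  refine ne_top_of_le_ne_top (ENNReal.add_ne_top.2 ⟨near, far⟩) ?_
  rw [← lintegral_add_left (by fun_prop)]
  refine lintegral_mono fun q => ?_
  calc ENNReal.ofReal (‖q.1‖ ^ (-α)) * ‖f q‖ₑ ^ p
      ≤ (w q.1 + 1) * ‖f q‖ₑ ^ p := by gcongr; exact weight_le q.1
    _ = w q.1 * ‖f q‖ₑ ^ p + ‖f q‖ₑ ^ p := by rw [add_mul, one_mul]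
    _ ≤ w q.1 * g q.2 + ‖f q‖ₑ ^ p := by gcongr; exact hfg q

end Decay

namespace Heisenberg

variable {n : ℕ}

theorem d_comm (w w' : Heisenberg n) : d w w' = d w' w := by
  have gauge_inv (u : Heisenberg n) : gauge u⁻¹ = gauge u := by
    change (‖-u.z‖ ^ 4 + (-u.t) ^ 2) ^ (1 / 4 : ℝ) = _
    rw [norm_neg, neg_sq, gauge]
  rw [d, d, ← gauge_inv, mul_inv_rev, inv_inv]

theorem d_eq (w w' : Heisenberg n) :
    d w w' = (‖w.z - w'.z‖ ^ 4 + (w.t - w'.t - 2 * imForm w'.z w.z) ^ 2) ^ (1 / 4 : ℝ) := by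
  have imForm_neg_left : imForm (-w'.z) w.z = -imForm w'.z w.z := by simp [imForm]
  change (‖-w'.z + w.z‖ ^ 4 + (-w'.t + w.t + 2 * imForm (-w'.z) w.z) ^ 2) ^ (1 / 4 : ℝ) = _
  rw [imForm_neg_left, neg_add_eq_sub]
  ring_nf

theorem d_rpow_neg (w w' : Heisenberg n) (s : ℝ) :
    d w w' ^ (-(4 * s)) =
      (‖w.z - w'.z‖ ^ 4 + (w.t - w'.t - 2 * imForm w'.z w.z) ^ 2) ^ (-s) := by
  rw [d_eq, ← Real.rpow_mul (by positivity)]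
  ring_nf

theorem measurable_d : Measurable fun q : Heisenberg n × Heisenberg n => d q.1 q.2 := by
  have z_meas : Measurable (z (n := n)) := measurable_fst
  have t_meas : Measurable (t (n := n)) := measurable_snd
  have imForm_cont : Continuous fun x : EuclideanSpace ℂ (Fin n) × EuclideanSpace ℂ (Fin n) =>
      imForm x.1 x.2 := by
    unfold imForm
    fun_prop
  have imForm_meas : Measurable fun q : Heisenberg n × Heisenberg n => imForm q.2.z q.1.z :=
    imForm_cont.measurable.comp (f := fun q : Heisenberg n × Heisenberg n => (q.2.z, q.1.z))
      (by fun_prop)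
  simp only [d_eq]
  fun_prop

theorem lintegral_d_rpow_right {s : ℝ} (hs : 1 / 2 < s) {z z' : EuclideanSpace ℂ (Fin n)}
    (hz : z ≠ z') (t : ℝ) :
    ∫⁻ t', ENNReal.ofReal (d (mk z t) (mk z' t') ^ (-(4 * s))) =
      ENNReal.ofReal (√Real.pi * Real.Gamma (s - 1 / 2) / Real.Gamma s) *
        ENNReal.ofReal (‖z - z'‖ ^ (2 - 4 * s)) := by
  have hpos : 0 < ‖z - z'‖ := norm_pos_iff.2 (sub_ne_zero.2 hz)
  calc ∫⁻ t', ENNReal.ofReal (d (mk z t) (mk z' t') ^ (-(4 * s)))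
      = ∫⁻ t', ENNReal.ofReal ((‖z - z'‖ ^ 4 + (t - 2 * imForm z' z - t') ^ 2) ^ (-s)) := by
        refine lintegral_congr fun t' => ?_
        rw [d_rpow_neg, sub_right_comm]
        rfl
    _ = ∫⁻ u : ℝ, ENNReal.ofReal ((‖z - z'‖ ^ 4 + u ^ 2) ^ (-s)) :=
        lintegral_sub_left_eq_self
          (fun u : ℝ => ENNReal.ofReal ((‖z - z'‖ ^ 4 + u ^ 2) ^ (-s))) _
    _ = _ := by
        rw [lintegral_add_sq_rpow_neg (by positivity) hs, ← Real.rpow_natCast,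
          ← Real.rpow_mul hpos.le]
        ring_nf

theorem lintegral_d_rpow_left {s : ℝ} (hs : 1 / 2 < s) {z z' : EuclideanSpace ℂ (Fin n)}
    (hz : z ≠ z') (t' : ℝ) :
    ∫⁻ t, ENNReal.ofReal (d (mk z t) (mk z' t') ^ (-(4 * s))) =
      ENNReal.ofReal (√Real.pi * Real.Gamma (s - 1 / 2) / Real.Gamma s) *
        ENNReal.ofReal (‖z - z'‖ ^ (2 - 4 * s)) := by
  simp only [d_comm _ (mk z' t')]
  rw [lintegral_d_rpow_right hs hz.symm, norm_sub_rev]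

theorem finrank_euclideanSpace_complex (n : ℕ) :
    finrank ℝ (EuclideanSpace ℂ (Fin n)) = 2 * n := by
  rw [← finrank_mul_finrank ℝ ℂ, Complex.finrank_real_complex, finrank_euclideanSpace_fin]

theorem hasFractionalMarginals_d_rpow {α : ℝ} (hα : -(2 * n) < α) :
    HasFractionalMarginals ((4 : ℝ≥0) ^ n • (volume : Measure ℝ))
      (fun q : Heisenberg n × Heisenberg n => ENNReal.ofReal (d q.1 q.2 ^ (-(2 * n + 2 + α)))) α
      (ENNReal.ofReal (4 ^ n * √Real.pi * Real.Gamma ((2 * n + α) / 4) /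
        Real.Gamma ((2 * n + 2 + α) / 4))) := by
  set s : ℝ := (2 * n + 2 + α) / 4 with hs_def
  have hs : 1 / 2 < s := by linarith
  have exponent : 2 * n + 2 + α = 4 * s := by ring
  have norm_exponent : -(finrank ℝ (EuclideanSpace ℂ (Fin n)) : ℝ) - α = 2 - 4 * s := by
    rw [finrank_euclideanSpace_complex]
    push_cast
    ring
  have gamma_arg : (2 * n + α) / 4 = s - 1 / 2 := by ring
  have const : ENNReal.ofReal (4 ^ n * √Real.pi * Real.Gamma (s - 1 / 2) / Real.Gamma s) =
      4 ^ n * ENNReal.ofReal (√Real.pi * Real.Gamma (s - 1 / 2) / Real.Gamma s) := by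
    rw [mul_assoc, mul_div_assoc, ENNReal.ofReal_mul (by positivity),
      ENNReal.ofReal_pow (by norm_num), ENNReal.ofReal_ofNat]
  rw [exponent, gamma_arg, const]
  refine ⟨(measurable_d.pow_const _).ennreal_ofReal, fun z z' t hz => ?_, fun z z' t' hz => ?_⟩
  · rw [lintegral_smul_measure, norm_exponent, mul_assoc]
    exact congrArg (4 ^ n * ·) (lintegral_d_rpow_right hs hz t)
  · rw [lintegral_smul_measure, norm_exponent, mul_assoc]
    exact congrArg (4 ^ n * ·) (lintegral_d_rpow_left hs hz t')

theorem haar_eq_prod (n : ℕ) :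
    haar n = (volume : Measure (EuclideanSpace ℂ (Fin n))).prod
      ((4 : ℝ≥0) ^ n • (volume : Measure ℝ)) := by
  rw [Measure.prod_smul_right]
  rfl

theorem exists_constF_eq (p β : ℝ) (η : EuclideanSpace ℝ (Fin (2 * n))) :
    ∃ ξ : EuclideanSpace ℂ (Fin n), ‖ξ‖ = ‖η‖ ∧ constF n p β η =
      ENNReal.ofReal (4 ^ n * √Real.pi * Real.Gamma ((2 * n + p * β) / 4) /
        Real.Gamma ((2 * n + 2 + p * β) / 4)) * fractionalHardyConst p (p * β) ξ := by
  have finrank_eq :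
      finrank ℝ (EuclideanSpace ℂ (Fin n)) = finrank ℝ (EuclideanSpace ℝ (Fin (2 * n))) := by
    rw [finrank_euclideanSpace_complex, finrank_euclideanSpace_fin]
  let R : EuclideanSpace ℂ (Fin n) ≃ₗᵢ[ℝ] EuclideanSpace ℝ (Fin (2 * n)) :=
    (stdOrthonormalBasis ℝ _).equiv (stdOrthonormalBasis ℝ _) (finCongr finrank_eq)
  refine ⟨R.symm η, R.symm.norm_map η, ?_⟩
  rw [← fractionalHardyConst_comp_isometry R, R.apply_symm_apply, fractionalHardyConst,
    finrank_euclideanSpace_fin, constF]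
  push_cast
  rfl

theorem ofReal_norm_rpow_div_d_rpow {V : Type*} [NormedAddCommGroup V] {p : ℝ} (hp : 0 ≤ p)
    (a : ℝ) (v : V) (w w' : Heisenberg n) :
    ENNReal.ofReal (‖v‖ ^ p / d w w' ^ a) = ‖v‖ₑ ^ p * ENNReal.ofReal (d w w' ^ (-a)) := by
  have hd : 0 ≤ d w w' := by
    rw [d_eq]
    positivity
  rw [← ofReal_norm, ENNReal.ofReal_rpow_of_nonneg (norm_nonneg _) hp,
    ← ENNReal.ofReal_mul (by positivity), div_eq_mul_inv, Real.rpow_neg hd]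

theorem ofReal_norm_z_rpow_mul {V : Type*} [NormedAddCommGroup V] {p : ℝ} (hp : 0 ≤ p)
    (a : ℝ) (v : V) (w : Heisenberg n) :
    ENNReal.ofReal (‖w.z‖ ^ a * ‖v‖ ^ p) = ENNReal.ofReal (‖w.z‖ ^ a) * ‖v‖ₑ ^ p := by
  rw [← ofReal_norm, ENNReal.ofReal_rpow_of_nonneg (norm_nonneg _) hp,
    ENNReal.ofReal_mul (by positivity)]

theorem lintegral_norm_z_rpow_mul_schwartz_ne_top {V : Type*} [NormedAddCommGroup V]
    [NormedSpace ℝ V] {α p : ℝ} (hα : 0 ≤ α) (hαn : α < 2 * n) (hp : 0 < p)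
    (f : SchwartzMap (Heisenberg n) V) :
    ∫⁻ w, ENNReal.ofReal (‖w.z‖ ^ (-α) * ‖f w‖ ^ p) ∂haar n ≠ ∞ := by
  have hαE : α < finrank ℝ (EuclideanSpace ℂ (Fin n)) := by
    rw [finrank_euclideanSpace_complex]
    exact_mod_cast hαn
  simp only [ofReal_norm_z_rpow_mul hp.le]
  rw [haar, lintegral_smul_measure]
  exact ENNReal.mul_ne_top ENNReal.coe_ne_top
    (lintegral_norm_fst_rpow_mul_schwartz_ne_top volume volume
      (E := EuclideanSpace ℂ (Fin n)) (F := ℝ) f hα hαE hp)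

end Heisenberg

theorem theorem8_general {V : Type*} [NormedAddCommGroup V] (n : ℕ) (p β : ℝ) (hp : 1 ≤ p)
    (hpβ : -(2 * n) < p * β) (f : Heisenberg n → V) (hf : StronglyMeasurable f)
    (hfin : ∫⁻ w, ENNReal.ofReal (‖w.z‖ ^ (-(p * β)) * ‖f w‖ ^ p) ∂(Heisenberg.haar n) ≠ ∞)
    (η : EuclideanSpace ℝ (Fin (2 * n))) (hη : ‖η‖ = 1) :
    Heisenberg.constF n p β η *
        ∫⁻ w, ENNReal.ofReal (‖w.z‖ ^ (-(p * β)) * ‖f w‖ ^ p) ∂(Heisenberg.haar n) ≤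
      ∫⁻ q : Heisenberg n × Heisenberg n,
        ENNReal.ofReal
          (‖f q.1 - f q.2‖ ^ p / Heisenberg.d q.1 q.2 ^ (2 * n + 2 + p * β))
        ∂((Heisenberg.haar n).prod (Heisenberg.haar n)) := by
  have hp0 : 0 ≤ p := by linarith
  obtain ⟨ξ, hξ, constF_eq⟩ := Heisenberg.exists_constF_eq p β η
  simp only [Heisenberg.ofReal_norm_z_rpow_mul hp0, Heisenberg.ofReal_norm_rpow_div_d_rpow hp0]
    at hfin ⊢
  rw [Heisenberg.haar_eq_prod] at hfin ⊢
  rw [constF_eq]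
  exact (Heisenberg.hasFractionalMarginals_d_rpow hpβ).hardy ENNReal.ofReal_ne_top hp
    (hξ.trans hη) hf hfin

theorem theorem8 (n : ℕ) (p β : ℝ) (hβ0 : 0 < β) (hβ1 : β < 1) (hp1 : 1 ≤ p)
    (hp2 : p < 2 * n / β) (f : SchwartzMap (Heisenberg n) ℂ)
    (η : EuclideanSpace ℝ (Fin (2 * n))) (hη : ‖η‖ = 1) :
    Heisenberg.constF n p β η *
        ∫⁻ w, ENNReal.ofReal (‖w.z‖ ^ (-(p * β)) * ‖f w‖ ^ p) ∂(Heisenberg.haar n) ≤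
      ∫⁻ q : Heisenberg n × Heisenberg n,
        ENNReal.ofReal
          (‖f q.1 - f q.2‖ ^ p / Heisenberg.d q.1 q.2 ^ (2 * n + 2 + p * β))
        ∂((Heisenberg.haar n).prod (Heisenberg.haar n)) := by
  have hpβ : 0 < p * β := by positivity
  exact theorem8_general n p β hp1 (lt_of_le_of_lt (neg_nonpos.2 (by positivity)) hpβ) f
    f.continuous.stronglyMeasurable
    (Heisenberg.lintegral_norm_z_rpow_mul_schwartz_ne_top hpβ.le ((lt_div_iff₀ hβ0).1 hp2)
      (by positivity) f) η hη
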